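/- Let $r\ge 2$ be an integer. For $n\ge 1$, an $r$-matching of $[rn]=\{1,\dots,rn\}$ is a partition of $[rn]$ into $r$-element subsets, called edges. For an $r$-matching $M$ of $[rn]$ and $k\in[rn]$, let $M_k$ be the set of edges of $M$ which have non-empty intersection with both $[k]$ and $[rn]\setminus[k]$, and put $x_k(M)=\sum_{e\in M_k}|e\cap[k]|$ (the sequence $(x_k(M))_{k=1}^{rn}$ is the sockuence of $M$). Let $\mathbb{RM}^{(r)}(n)$ be chosen uniformly at random among all $\frac{(rn)!}{(r!)^n\,n!}$ $r$-matchings of $[rn]$, and let $Y^{(r)}=\max_{k\in[rn]}x_k(\mathbb{RM}^{(r)}(n))$ be its $r$-sock number. Then for every $r\ge2$ there exists a constant $C>0$, depending only on $r$, such that $$\lim_{n\to\infty}\mathbb{P}\left(\left|Y^{(r)}-\frac{(r-1)n}{r^{1/(r-1)}}\right|\le C\sqrt{n\log n}\right)=1 .$$ -/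

import Mathlib

/-- The ground set `[m] = {1, …, m}`. -/
abbrev initSeg (m : ℕ) : Finset ℕ := Finset.Icc 1 m

/-- An (ordered) `r`-matching of size `n`: a partition of `[rn]` into `r`-element subsets
(its edges). -/
def RMatching (r n : ℕ) : Type :=
  {M : Finpartition (initSeg (r * n)) // ∀ e ∈ M.parts, e.card = r}

namespace RMatching

/-- The finite set of edges of an `r`-matching. -/
def edges {r n : ℕ} (M : RMatching r n) : Finset (Finset ℕ) := M.1.parts

/-- `M_k`: the edges of `M` that meet both `[k]` and `[rn] \ [k]`. -/
def crossingEdges {r n : ℕ} (M : RMatching r n) (k : ℕ) : Finset (Finset ℕ) :=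
  M.edges.filter fun e =>
    (e ∩ initSeg k).Nonempty ∧ (e ∩ (initSeg (r * n) \ initSeg k)).Nonempty

/-- The sockuence of `M`: `x_k(M) = ∑_{e ∈ M_k} |e ∩ [k]|`. -/
def sockuence {r n : ℕ} (M : RMatching r n) (k : ℕ) : ℕ :=
  ∑ e ∈ M.crossingEdges k, (e ∩ initSeg k).card

/-- The `r`-sock number of `M`: the maximum of `x_k(M)` over `k ∈ [rn]`. -/
def sockNumber {r n : ℕ} (M : RMatching r n) : ℕ :=
  (initSeg (r * n)).sup M.sockuence

/-- Every set of `r`-matchings is an event. -/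
instance (r n : ℕ) : MeasurableSpace (RMatching r n) := ⊤

/-- The law of the random `r`-matching of `[rn]`: the uniform distribution on the (finite) set
of all `r`-matchings of `[rn]`. -/
noncomputable def uniformLaw (r n : ℕ) : MeasureTheory.Measure (RMatching r n) :=
  ProbabilityTheory.uniformOn Set.univ

end RMatching

/-! Let I_k be the number of edges inside [k]. An edge inside [k] would add r to the sockuence if it
were counted, and an edge outside adds 0, so x_k = k - r I_k (`sockuence_add_mul_innerCount`) and
only I_k needs study.

A uniform matching consists of the colour classes of a fixed balanced colouring composed with a
uniform permutation (`card_filter_mul_card_perm`). In this model I_k has mean n C(k,r)/C(rn,r),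
which is n t^r + O(1) for t = k/(rn). A transposition affects at most two colours, so I_k is
subgaussian on the scale √(rn) (`card_perm_le_abs_sub_expect`), and a union bound over the rn values
of k costs a factor √(log n).

Hence x_k is uniformly close to rn(t - t^r). This is largest at τ = r^(-1/(r-1)), where rτ^(r-1) =
1, and its value there is (r-1)nτ (`abs_sockNumber_sub_le`). -/

/-! ### Bounded differences on the symmetric group -/

section Concentration

open Finset Equiv
open scoped BigOperators

/-- Hoeffding's lemma for the uniform distribution on a finite type. -/
theorem expect_exp_le_of_abs_sub_le {ι : Type*} [Fintype ι] [Nonempty ι] (a : ι → ℝ) (a₀ c l : ℝ)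
    (ha : ∀ i, |a i - a₀| ≤ c) :
    𝔼 i, Real.exp (l * a i) ≤ Real.exp (l * 𝔼 i, a i + 2 * l ^ 2 * c ^ 2) := by
  -- Jensen's inequality, by the tangent line of exp at the mean. It allows the mean to be replaced
  -- by an independent copy `a j`; symmetrising then turns exp into cosh. As |a i - a j| ≤ 2c and
  -- cosh x ≤ exp(x²/2), the exponent is l²(2c)²/2 = 2l²c².
  have hexp : Real.exp (-(l * 𝔼 i, a i)) ≤ 𝔼 j, Real.exp (-(l * a j)) := by
    have h : ∀ j, Real.exp (-(l * 𝔼 i, a i)) * (1 + l * 𝔼 i, a i - l * a j)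
        ≤ Real.exp (-(l * a j)) := fun j => by
      have h1 := Real.add_one_le_exp (l * 𝔼 i, a i - l * a j)
      calc _ ≤ Real.exp (-(l * 𝔼 i, a i)) * Real.exp (l * 𝔼 i, a i - l * a j) := by
            gcongr; linarith
        _ = _ := by rw [← Real.exp_add]; ring_nf
    have h2 := expect_le_expect (s := univ) (fun j _ => h j)
    rw [← mul_expect, expect_sub_distrib, ← mul_expect, Fintype.expect_const] at h2
    simpa using h2
  have hsymm : 𝔼 i, 𝔼 j, Real.exp (l * (a i - a j))
      = 𝔼 i, 𝔼 j, Real.cosh (l * (a i - a j)) := by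
    have h1 : 𝔼 i, 𝔼 j, Real.exp (l * (a i - a j)) = 𝔼 i, 𝔼 j, Real.exp (-(l * (a i - a j))) := by
      rw [expect_comm]
      refine expect_congr rfl fun i _ => expect_congr rfl fun j _ => ?_
      congr 1; ring
    have h2 : 𝔼 i, 𝔼 j, Real.cosh (l * (a i - a j))
        = (𝔼 i, 𝔼 j, Real.exp (l * (a i - a j))
          + 𝔼 i, 𝔼 j, Real.exp (-(l * (a i - a j)))) / 2 := by
      simp only [Real.cosh_eq, ← expect_div, expect_add_distrib]
    rw [h2, ← h1]; ring
  have hcosh : 𝔼 i, 𝔼 j, Real.cosh (l * (a i - a j)) ≤ Real.exp (2 * l ^ 2 * c ^ 2) := by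
    refine expect_le univ_nonempty fun i _ => expect_le univ_nonempty fun j _ => ?_
    refine (Real.cosh_le_exp_half_sq _).trans (Real.exp_le_exp.2 ?_)
    have hd : |a i - a j| ≤ 2 * c := by
      have := abs_sub_le (a i) a₀ (a j)
      have h2 := ha j
      rw [abs_sub_comm] at h2
      linarith [ha i]
    have : (a i - a j) ^ 2 ≤ (2 * c) ^ 2 := sq_le_sq' (abs_le.1 hd).1 (abs_le.1 hd).2
    nlinarith [mul_le_mul_of_nonneg_left this (sq_nonneg l)]
  have hprod : (𝔼 i, Real.exp (l * a i)) * 𝔼 j, Real.exp (-(l * a j))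
      = 𝔼 i, 𝔼 j, Real.exp (l * (a i - a j)) := by
    rw [expect_mul_expect]
    refine expect_congr rfl fun i _ => expect_congr rfl fun j _ => ?_
    rw [← Real.exp_add]; congr 1; ring
  have hpos : 0 ≤ 𝔼 i, Real.exp (l * a i) := expect_nonneg fun i _ => (Real.exp_pos _).le
  have key : (𝔼 i, Real.exp (l * a i)) * Real.exp (-(l * 𝔼 i, a i))
      ≤ Real.exp (2 * l ^ 2 * c ^ 2) :=
    (mul_le_mul_of_nonneg_left hexp hpos).trans (by rw [hprod, hsymm]; exact hcosh)
  rw [Real.exp_neg, ← div_eq_mul_inv, div_le_iff₀ (Real.exp_pos _), ← Real.exp_add] at key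
  rwa [add_comm]

/-- Changing the image of 0 costs a single left transposition, so the bounded-difference hypothesis
compares the conditional means for different `p`. -/
theorem decomposeFin_symm_eq_swap_mul {n : ℕ} (p : Fin (n + 1)) (e : Perm (Fin n)) :
    Perm.decomposeFin.symm (p, e) = swap 0 p * Perm.decomposeFin.symm (0, e) := by
  ext i
  refine Fin.cases ?_ (fun j => ?_) i <;> simp

theorem decomposeFin_symm_zero_swap_mul {n : ℕ} (x y : Fin n) (e : Perm (Fin n)) :
    Perm.decomposeFin.symm (0, swap x y * e)
      = swap x.succ y.succ * Perm.decomposeFin.symm (0, e) := by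
  ext i
  refine Fin.cases ?_ (fun j => ?_) i
  · simp [swap_apply_of_ne_of_ne, (Fin.succ_ne_zero _).symm]
  · simp only [Perm.decomposeFin_symm_apply_succ, Perm.mul_apply, swap_self, refl_apply]
    congr 1
    exact (Fin.succ_injective n).map_swap ..

/-- A bounded-difference inequality: the moment generating function of a function of a uniformly
random permutation that changes by at most `c` under transpositions is subgaussian. -/
theorem expect_exp_perm_fin_le (m : ℕ) (c l : ℝ) (f : Perm (Fin m) → ℝ)
    (hf : ∀ σ x y, |f (swap x y * σ) - f σ| ≤ c) :
    𝔼 σ, Real.exp (l * f σ) ≤ Real.exp (l * 𝔼 σ, f σ + 2 * l ^ 2 * c ^ 2 * m) := by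
  induction m with
  | zero => simp
  | succ m ih =>
    have hsplit : ∀ g : Perm (Fin (m + 1)) → ℝ,
        𝔼 σ, g σ = 𝔼 p : Fin (m + 1), 𝔼 e : Perm (Fin m), g (Perm.decomposeFin.symm (p, e)) := by
      intro g
      rw [← expect_product' univ univ (fun p e => g (Perm.decomposeFin.symm (p, e)))]
      exact Fintype.expect_equiv Perm.decomposeFin _ _ fun σ => by simp
    have hinner : ∀ p : Fin (m + 1),
        𝔼 e : Perm (Fin m), Real.exp (l * f (Perm.decomposeFin.symm (p, e)))
          ≤ Real.exp (l * 𝔼 e : Perm (Fin m), f (Perm.decomposeFin.symm (p, e))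
              + 2 * l ^ 2 * c ^ 2 * m) := by
      intro p
      refine ih (fun e => f (Perm.decomposeFin.symm (p, e))) fun σ x y => ?_
      -- Moving `swap 0 p` past the lifted transposition conjugates it into another transposition,
      -- so the same `c` serves for every fixed `p`.
      rw [decomposeFin_symm_eq_swap_mul, decomposeFin_symm_zero_swap_mul, ← mul_assoc,
        mul_swap_eq_swap_mul, mul_assoc, ← decomposeFin_symm_eq_swap_mul]
      exact hf _ _ _
    have houter : 𝔼 p : Fin (m + 1),
        Real.exp (l * 𝔼 e : Perm (Fin m), f (Perm.decomposeFin.symm (p, e)))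
          ≤ Real.exp (l * 𝔼 p : Fin (m + 1), 𝔼 e : Perm (Fin m),
              f (Perm.decomposeFin.symm (p, e)) + 2 * l ^ 2 * c ^ 2) := by
      refine expect_exp_le_of_abs_sub_le _
        (𝔼 e : Perm (Fin m), f (Perm.decomposeFin.symm (0, e))) c l fun p => ?_
      rw [← expect_sub_distrib]
      refine (abs_expect_le _ _).trans (expect_le univ_nonempty fun e _ => ?_)
      rw [decomposeFin_symm_eq_swap_mul]
      exact hf _ _ _
    rw [hsplit, hsplit f]
    calc _ ≤ 𝔼 p : Fin (m + 1),
          Real.exp (l * 𝔼 e : Perm (Fin m), f (Perm.decomposeFin.symm (p, e))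
              + 2 * l ^ 2 * c ^ 2 * m) := expect_le_expect fun p _ => hinner p
      _ = (𝔼 p : Fin (m + 1),
          Real.exp (l * 𝔼 e : Perm (Fin m), f (Perm.decomposeFin.symm (p, e))))
            * Real.exp (2 * l ^ 2 * c ^ 2 * m) := by
          rw [expect_mul]; simp only [Real.exp_add]
      _ ≤ _ := by
          refine (mul_le_mul_of_nonneg_right houter (Real.exp_pos _).le).trans_eq ?_
          rw [← Real.exp_add]; push_cast; congr 1; ring

theorem expect_exp_perm_le {α : Type*} [Fintype α] [DecidableEq α] (c l : ℝ) (f : Perm α → ℝ)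
    (hf : ∀ σ x y, |f (swap x y * σ) - f σ| ≤ c) :
    𝔼 σ, Real.exp (l * f σ)
      ≤ Real.exp (l * 𝔼 σ, f σ + 2 * l ^ 2 * c ^ 2 * Fintype.card α) := by
  let e := Fintype.equivFin α
  have hE : ∀ g : Perm α → ℝ, 𝔼 σ, g σ = 𝔼 τ, g (e.symm.permCongr τ) := fun g =>
    Fintype.expect_equiv e.permCongr _ _ fun σ => by
      congr 1; ext x; simp [permCongr_apply]
  rw [hE, hE f]
  refine expect_exp_perm_fin_le _ c l (fun τ => f (e.symm.permCongr τ)) fun σ x y => ?_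
  have : e.symm.permCongr (swap x y * σ)
      = swap (e.symm x) (e.symm y) * e.symm.permCongr σ := by
    ext z
    simp only [permCongr_apply, Perm.mul_apply, symm_symm]
    exact e.symm.injective.map_swap ..
  rw [this]
  exact hf _ _ _

theorem card_perm_le_sub_expect {α : Type*} [Fintype α] [Nonempty α] [DecidableEq α]
    {c t : ℝ} (hc : 0 < c) (ht : 0 ≤ t) (f : Perm α → ℝ)
    (hf : ∀ σ x y, |f (swap x y * σ) - f σ| ≤ c) :
    (#{σ | t ≤ f σ - 𝔼 τ, f τ} : ℝ)
      ≤ Real.exp (-(t ^ 2 / (8 * c ^ 2 * Fintype.card α))) * Fintype.card (Perm α) := by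
  have hm : (0 : ℝ) < Fintype.card α := by exact_mod_cast Fintype.card_pos
  -- The minimiser of the Chernoff exponent -lt + 2l²c²m, where m is the cardinality of `α`.
  set l : ℝ := t / (4 * c ^ 2 * Fintype.card α) with hl
  have hl0 : 0 ≤ l := by positivity
  have hmgf := expect_exp_perm_le c l f hf
  rw [Fintype.expect_eq_sum_div_card, div_le_iff₀ (by exact_mod_cast Fintype.card_pos)] at hmgf
  have hmarkov : (#{σ | t ≤ f σ - 𝔼 τ, f τ} : ℝ) * Real.exp (l * (t + 𝔼 τ, f τ))
      ≤ ∑ σ, Real.exp (l * f σ) := by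
    rw [← nsmul_eq_mul]
    refine (card_nsmul_le_sum _ _ _ fun σ hσ => ?_).trans
      (sum_le_sum_of_subset_of_nonneg (filter_subset _ _) fun _ _ _ => (Real.exp_pos _).le)
    have := (mem_filter.1 hσ).2
    exact Real.exp_le_exp.2 (mul_le_mul_of_nonneg_left (by linarith) hl0)
  have h := hmarkov.trans hmgf
  rw [← le_div_iff₀ (Real.exp_pos _)] at h
  refine h.trans_eq ?_
  rw [mul_comm, mul_div_assoc, ← Real.exp_sub, mul_comm]
  congr 2
  rw [hl]
  field_simp
  ring

/-- Two-sided concentration for functions of a uniformly random permutation. -/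
theorem card_perm_le_abs_sub_expect {α : Type*} [Fintype α] [Nonempty α] [DecidableEq α]
    {c t : ℝ} (hc : 0 < c) (ht : 0 ≤ t) (f : Perm α → ℝ)
    (hf : ∀ σ x y, |f (swap x y * σ) - f σ| ≤ c) :
    (#{σ | t ≤ |f σ - 𝔼 τ, f τ|} : ℝ)
      ≤ 2 * Real.exp (-(t ^ 2 / (8 * c ^ 2 * Fintype.card α))) * Fintype.card (Perm α) := by
  have h1 := card_perm_le_sub_expect hc ht f hf
  have h2 := card_perm_le_sub_expect hc ht (fun σ => -f σ) fun σ x y => by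
    rw [neg_sub_neg, abs_sub_comm]; exact hf σ x y
  have hsub : univ.filter (fun σ => t ≤ |f σ - 𝔼 τ, f τ|)
      ⊆ univ.filter (fun σ => t ≤ f σ - 𝔼 τ, f τ)
        ∪ univ.filter (fun σ => t ≤ -f σ - 𝔼 τ, -f τ) := by
    intro σ hσ
    simp only [mem_union, mem_filter, mem_univ, true_and, expect_neg_distrib] at hσ ⊢
    refine (le_abs'.1 hσ).symm.imp id fun h => by linarith
  have h3 : (#{σ | t ≤ |f σ - 𝔼 τ, f τ|} : ℝ) ≤ _ :=
    Nat.cast_le.2 ((card_le_card hsub).trans (card_union_le _ _))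
  push_cast at h3
  linarith

end Concentration

/-! ### Fibres of a randomly permuted colouring -/

section PermCounting

open Finset Equiv
open scoped BigOperators

theorem exists_perm_image_eq {α : Type*} [Fintype α] [DecidableEq α] {s t : Finset α}
    (h : #s = #t) : ∃ τ : Perm α, s.image τ = t := by
  let e : {x // x ∈ s} ≃ {x // x ∈ t} := Finset.equivOfCardEq h
  refine ⟨e.extendSubtype, eq_of_subset_of_card_le (fun y hy => ?_) ?_⟩
  · obtain ⟨x, hx, rfl⟩ := mem_image.1 hy
    rw [e.extendSubtype_apply_of_mem x hx]
    exact (e ⟨x, hx⟩).2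
  · rw [card_image_of_injective _ (Equiv.injective _), h]

theorem card_filter_image_perm_subset {α : Type*} [Fintype α] [DecidableEq α]
    (σ : Perm α) (K : Finset α) (r : ℕ) :
    #{s ∈ powersetCard r univ | s.image σ ⊆ K} = (#K).choose r := by
  rw [← card_powersetCard]
  refine card_nbij' (fun s => s.image σ) (fun s => s.image σ.symm) ?_ ?_ ?_ ?_
  · intro s hs
    simp only [coe_filter, Set.mem_ofPred_eq, mem_powersetCard, mem_coe] at hs ⊢
    exact ⟨hs.2, by rw [card_image_of_injective _ σ.injective, hs.1.2]⟩
  · intro s hs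
    simp only [coe_filter, Set.mem_ofPred_eq, mem_powersetCard, mem_coe] at hs ⊢
    refine ⟨⟨subset_univ _, by rw [card_image_of_injective _ σ.symm.injective, hs.2]⟩, ?_⟩
    simpa [image_image] using hs.1
  · intro s _; simp [image_image]
  · intro s _; simp [image_image]

/-- Double counting of the pairs (s, σ) with #s = #B and σ(s) ⊆ K. The count over σ is the same for
every s, since right multiplication by a permutation carries any such set to any other. -/
theorem card_perm_image_subset_mul {α : Type*} [Fintype α] [DecidableEq α] (B K : Finset α) :
    #{σ : Perm α | B.image σ ⊆ K} * (Fintype.card α).choose #B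
      = Fintype.card (Perm α) * (#K).choose #B := by
  have hB : ∀ s ∈ powersetCard #B (univ : Finset α),
      #{σ : Perm α | s.image σ ⊆ K} = #{σ : Perm α | B.image σ ⊆ K} := by
    intro s hs
    obtain ⟨τ, hτ⟩ := exists_perm_image_eq (mem_powersetCard.1 hs).2.symm
    refine card_equiv (Equiv.mulRight τ) fun σ => ?_
    simp [← hτ, image_image, Perm.coe_mul]
  have h1 : ∑ s ∈ powersetCard #B (univ : Finset α), #{σ : Perm α | s.image σ ⊆ K}
      = ∑ σ : Perm α, #{s ∈ powersetCard #B (univ : Finset α) | s.image σ ⊆ K} :=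
    sum_card_bipartiteAbove_eq_sum_card_bipartiteBelow _
  rw [sum_congr rfl hB] at h1
  simp only [card_filter_image_perm_subset, sum_const, card_powersetCard, card_univ,
    smul_eq_mul] at h1
  rw [mul_comm, h1]

/-- The expected number of fibres of a uniformly permuted colouring that lie inside `K`. -/
theorem expect_card_fiber_subset {α ι : Type*} [Fintype α] [DecidableEq α] [Fintype ι]
    [DecidableEq ι] (b : α → ι) {r : ℕ} (hb : ∀ i, #{x | b x = i} = r) (hr : r ≤ Fintype.card α)
    (K : Finset α) :
    𝔼 σ : Perm α, (#{i : ι | ∀ x, b (σ x) = i → x ∈ K} : ℝ)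
      = Fintype.card ι * ((#K).choose r / (Fintype.card α).choose r) := by
  have hswap : ∑ σ : Perm α, #{i : ι | ∀ x, b (σ x) = i → x ∈ K}
      = ∑ i : ι, #{σ : Perm α | ∀ x, b (σ x) = i → x ∈ K} :=
    sum_card_bipartiteAbove_eq_sum_card_bipartiteBelow _
  have hone : ∀ i : ι, (#{σ : Perm α | ∀ x, b (σ x) = i → x ∈ K} : ℝ)
      = Fintype.card (Perm α) * ((#K).choose r / (Fintype.card α).choose r) := by
    intro i
    have h := card_perm_image_subset_mul ({x | b x = i} : Finset α) K
    rw [hb] at h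
    have he : #{σ : Perm α | ∀ x, b (σ x) = i → x ∈ K}
        = #{σ : Perm α | ({x | b x = i} : Finset α).image σ ⊆ K} := by
      -- The fibre of `b ∘ σ` over `i` is the image of that of `b` under σ⁻¹, hence the inversion.
      refine card_equiv (Equiv.inv _) fun σ => ?_
      simp only [mem_filter, mem_univ, true_and, Equiv.inv_apply, image_subset_iff]
      constructor
      · intro hx x hxi; exact hx _ (by simpa using hxi)
      · intro hx x hxi; simpa using hx (σ x) hxi
    rw [he, ← mul_div_assoc, eq_div_iff (by exact_mod_cast (Nat.choose_pos hr).ne')]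
    exact_mod_cast h
  have hP : (Fintype.card (Perm α) : ℝ) ≠ 0 := by exact_mod_cast Fintype.card_ne_zero
  rw [Fintype.expect_eq_sum_div_card, div_eq_iff hP, ← Nat.cast_sum, hswap, Nat.cast_sum,
    sum_congr rfl fun i _ => hone i]
  simp only [sum_const, card_univ, nsmul_eq_mul]
  ring

/-- Only the fibres over `b x` and `b y` can change. -/
theorem abs_card_fiber_subset_swap_sub_le {α ι : Type*} [Fintype α] [DecidableEq α] [Fintype ι]
    [DecidableEq ι] (b : α → ι) (K : Finset α) (σ : Perm α) (x y : α) :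
    |(#{i : ι | ∀ z, b ((swap x y * σ) z) = i → z ∈ K} : ℝ)
      - #{i : ι | ∀ z, b (σ z) = i → z ∈ K}| ≤ 2 := by
  have key : ∀ τ ρ : Perm α, (∀ z, b (τ z) ≠ b x → b (τ z) ≠ b y → ρ z = τ z) →
      #{i : ι | ∀ z, b (ρ z) = i → z ∈ K} ≤ #{i : ι | ∀ z, b (τ z) = i → z ∈ K} + 2 := by
    intro τ ρ h
    have hsub : univ.filter (fun i : ι => ∀ z, b (ρ z) = i → z ∈ K)
        ⊆ univ.filter (fun i : ι => ∀ z, b (τ z) = i → z ∈ K) ∪ {b x, b y} := by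
      intro i hi
      simp only [mem_union, mem_filter, mem_univ, true_and, mem_insert, mem_singleton] at hi ⊢
      by_cases hx : i = b x
      · exact Or.inr (Or.inl hx)
      by_cases hy : i = b y
      · exact Or.inr (Or.inr hy)
      refine Or.inl fun z hz => hi z ?_
      subst hz
      rw [h z hx hy]
    exact (card_le_card hsub).trans ((card_union_le _ _).trans (by gcongr; exact card_le_two))
  have h1 := key σ (swap x y * σ) fun z hx hy => by
    rw [Perm.mul_apply, swap_apply_of_ne_of_ne] <;> rintro rfl <;> simp_all
  have h2 := key (swap x y * σ) σ fun z hx hy => by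
    rw [Perm.mul_apply] at hx hy ⊢
    have hzx : σ z ≠ x := by rintro rfl; simp at hy
    have hzy : σ z ≠ y := by rintro rfl; simp at hx
    rw [swap_apply_of_ne_of_ne hzx hzy]
  rw [abs_sub_le_iff, sub_le_iff_le_add, sub_le_iff_le_add, add_comm (2 : ℝ), add_comm (2 : ℝ)]
  exact ⟨by exact_mod_cast h1, by exact_mod_cast h2⟩

/-- A surjection from a finite group whose kernel relation is right invariant pushes the uniform
distribution to the uniform distribution. -/
theorem card_filter_mul_card_of_surjective {G X : Type*} [Group G] [Fintype G] [Fintype X]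
    [DecidableEq X] (φ : G → X) (hφ : Function.Surjective φ)
    (hinv : ∀ g h k, φ g = φ h → φ (g * k) = φ (h * k)) (P : X → Prop) [DecidablePred P] :
    #{x | P x} * Fintype.card G = #{g | P (φ g)} * Fintype.card X := by
  have hle : ∀ x y, #{g | φ g = x} ≤ #{g | φ g = y} := by
    intro x y
    obtain ⟨g, rfl⟩ := hφ x
    obtain ⟨h, rfl⟩ := hφ y
    -- Right multiplication by g⁻¹h sends the fibre through g into the fibre through h, so all
    -- fibres have equal size.
    refine card_le_card_of_injOn (· * (g⁻¹ * h)) (fun a ha => ?_)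
      (mul_left_injective _).injOn
    simp only [coe_filter, mem_univ, true_and, Set.mem_ofPred_eq] at ha ⊢
    simpa using hinv _ _ (g⁻¹ * h) ha
  obtain ⟨x₀, -⟩ : ∃ x : X, True := ⟨φ 1, trivial⟩
  have hF : ∀ x, #{g | φ g = x} = #{g | φ g = x₀} := fun x => (hle _ _).antisymm (hle _ _)
  have h1 : Fintype.card G = Fintype.card X * #{g | φ g = x₀} := by
    rw [← card_univ, card_eq_sum_card_fiberwise (f := φ) (t := univ) fun _ _ => by simp]
    simp [hF]
  have h2 : #{g | P (φ g)} = #{x | P x} * #{g | φ g = x₀} := by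
    rw [card_eq_sum_card_fiberwise (f := φ) (t := {x | P x}) fun g hg => by simpa using hg,
      ← smul_eq_mul, ← sum_const]
    refine sum_congr rfl fun x hx => ?_
    rw [← hF x, filter_filter]
    congr 1
    ext g
    simp only [mem_filter, mem_univ, true_and] at hx ⊢
    exact ⟨fun h => h.2, fun h => ⟨h ▸ hx, h⟩⟩
  rw [h1, h2]; ring

end PermCounting

/-! ### Matchings as colour classes -/

namespace RMatching

open Finset

noncomputable instance instFintype (r n : ℕ) : Fintype (RMatching r n) :=
  inferInstanceAs (Fintype {M : Finpartition (initSeg (r * n)) // ∀ e ∈ M.parts, e.card = r})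

/-- The number of edges of `M` contained in `[k]`. -/
def innerCount {r n : ℕ} (M : RMatching r n) (k : ℕ) : ℕ := #{e ∈ M.edges | e ⊆ initSeg k}

theorem sockuence_add_mul_innerCount {r n : ℕ} (M : RMatching r n) {k : ℕ}
    (hk : k ≤ r * n) : M.sockuence k + r * M.innerCount k = k := by
  have htotal : ∑ e ∈ M.edges, #(e ∩ initSeg k) = k := by
    have hdisj : (M.edges : Set (Finset ℕ)).PairwiseDisjoint fun e => e ∩ initSeg k :=
      fun e he f hf hef => (M.1.disjoint he hf hef).mono inter_subset_left inter_subset_left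
    rw [← card_biUnion hdisj, ← biUnion_inter]
    have : M.edges.biUnion (fun e => e) = initSeg (r * n) := M.1.biUnion_parts
    rw [this, inter_eq_right.2 (Icc_subset_Icc_right hk)]
    simp
  have hinner : r * M.innerCount k = ∑ e ∈ M.edges, if e ⊆ initSeg k then r else 0 := by
    rw [← sum_filter, sum_const, smul_eq_mul, mul_comm, innerCount]
  rw [sockuence, crossingEdges, sum_filter, hinner, ← sum_add_distrib]
  refine Eq.trans (sum_congr rfl fun e he => ?_) htotal
  have hcard : #e = r := M.2 e he
  have hsub : e ⊆ initSeg (r * n) := M.1.subset he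
  by_cases h : e ⊆ initSeg k
  · have hempty : e ∩ (initSeg (r * n) \ initSeg k) = ∅ := by
      ext x; simp only [mem_inter, mem_sdiff, notMem_empty, iff_false]
      exact fun hx => hx.2.2 (h hx.1)
    rw [if_neg (by rw [hempty]; simp), if_pos h, inter_eq_left.2 h, hcard, zero_add]
  · rw [if_neg h, add_zero]
    split_ifs with h1
    · rfl
    · obtain ⟨x, hx, hxk⟩ := not_subset.1 h
      have h2 : ¬ (e ∩ initSeg k).Nonempty := fun h3 =>
        h1 ⟨h3, x, mem_inter.2 ⟨hx, mem_sdiff.2 ⟨hsub hx, hxk⟩⟩⟩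
      rw [not_nonempty_iff_eq_empty.1 h2, card_empty]

/-- The set of points of colour `i`. -/
def colorClass {S : Finset ℕ} {ι : Type*} [DecidableEq ι] (c : ↥S → ι) (i : ι) : Finset ℕ :=
  (univ.filter fun x => c x = i).map (Function.Embedding.subtype _)

theorem mem_colorClass {S : Finset ℕ} {ι : Type*} [DecidableEq ι] {c : ↥S → ι} {i : ι} {a : ℕ} :
    a ∈ colorClass c i ↔ ∃ h : a ∈ S, c ⟨a, h⟩ = i := by
  simp [colorClass]

theorem card_colorClass {S : Finset ℕ} {ι : Type*} [DecidableEq ι] (c : ↥S → ι) (i : ι) :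
    #(colorClass c i) = #{x | c x = i} := card_map _

/-- The `r`-matching whose edges are the colour classes of a colouring. -/
def ofColoring {r n : ℕ} (hr : 0 < r) (c : ↥(initSeg (r * n)) → Fin n)
    (hc : ∀ i, #{x | c x = i} = r) : RMatching r n :=
  ⟨Finpartition.ofExistsUnique (univ.image (colorClass c))
    (by
      simp only [mem_image, mem_univ, true_and, forall_exists_index, forall_apply_eq_imp_iff]
      exact fun i a ha => (mem_colorClass.1 ha).1)
    (fun a ha => by
      refine ⟨colorClass c (c ⟨a, ha⟩),
        ⟨mem_image_of_mem _ (mem_univ _), mem_colorClass.2 ⟨ha, rfl⟩⟩, ?_⟩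
      rintro t ⟨ht, hat⟩
      obtain ⟨i, -, rfl⟩ := mem_image.1 ht
      obtain ⟨_, rfl⟩ := mem_colorClass.1 hat
      rfl)
    (fun h => by
      obtain ⟨i, -, hi⟩ := mem_image.1 h
      have := card_colorClass c i
      rw [hi, hc, card_empty] at this
      omega),
  fun e he => by
    obtain ⟨i, -, rfl⟩ := mem_image.1 he
    rw [card_colorClass, hc]⟩

theorem edges_ofColoring {r n : ℕ} (hr : 0 < r) (c : ↥(initSeg (r * n)) → Fin n)
    (hc : ∀ i, #{x | c x = i} = r) :
    (ofColoring hr c hc).edges = univ.image (colorClass c) := rfl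

theorem ext_edges {r n : ℕ} {M N : RMatching r n} (h : M.edges = N.edges) : M = N :=
  Subtype.ext (Finpartition.ext h)

theorem ofColoring_eq_iff {r n : ℕ} (hr : 0 < r) {c c' : ↥(initSeg (r * n)) → Fin n}
    (hc : ∀ i, #{x | c x = i} = r) (hc' : ∀ i, #{x | c' x = i} = r) :
    ofColoring hr c hc = ofColoring hr c' hc' ↔ ∀ x y, c x = c y ↔ c' x = c' y := by
  constructor
  · intro h x y
    have hedges : univ.image (colorClass c) = univ.image (colorClass c') := by
      rw [← edges_ofColoring hr c hc, h, edges_ofColoring]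
    obtain ⟨j, -, hj⟩ := mem_image.1 (hedges ▸ mem_image_of_mem (colorClass c) (mem_univ (c x)))
    have hmem : ∀ z, c z = c x ↔ c' z = j := fun z => by
      have : (z : ℕ) ∈ colorClass c (c x) ↔ (z : ℕ) ∈ colorClass c' j := by rw [hj]
      simpa [mem_colorClass] using this
    have hx := (hmem x).1 rfl
    rw [eq_comm, hmem, ← hx, eq_comm]
  · intro h
    have hsub : ∀ {d d' : ↥(initSeg (r * n)) → Fin n}, (∀ i, #{x | d x = i} = r) →
        (∀ x y, d x = d y ↔ d' x = d' y) →
        univ.image (colorClass d) ⊆ univ.image (colorClass d') := by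
      intro d d' hd hdd e he
      obtain ⟨i, -, rfl⟩ := mem_image.1 he
      obtain ⟨x, hx⟩ : ({x | d x = i} : Finset _).Nonempty := by
        rw [← card_pos, hd]; exact hr
      have hx := (mem_filter.1 hx).2
      refine mem_image.2 ⟨d' x, mem_univ _, ?_⟩
      ext a
      simp only [mem_colorClass, ← hx]
      exact exists_congr fun ha => (hdd _ _).symm
    exact ext_edges ((hsub hc h).antisymm (hsub hc' fun x y => (h x y).symm))

theorem card_edges {r n : ℕ} (hr : 0 < r) (M : RMatching r n) : #M.edges = n := by
  have h := M.1.sum_card_parts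
  rw [sum_congr rfl M.2, sum_const, Nat.card_Icc, smul_eq_mul, add_tsub_cancel_right,
    mul_comm] at h
  exact Nat.eq_of_mul_eq_mul_left hr h

theorem exists_eq_ofColoring {r n : ℕ} (hr : 0 < r) (M : RMatching r n) :
    ∃ c hc, M = ofColoring hr c hc := by
  let e : M.edges ≃ Fin n := M.edges.equivFinOfCardEq (card_edges hr M)
  let c : ↥(initSeg (r * n)) → Fin n := fun x => e ⟨M.1.part x, M.1.part_mem.2 x.2⟩
  have hclass : ∀ i, colorClass c i = (e.symm i).1 := fun i => by
    ext a
    rw [mem_colorClass]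
    constructor
    · rintro ⟨ha, rfl⟩
      simpa [c] using M.1.mem_part_self.2 ha
    · intro ha
      have hmem : (e.symm i).1 ∈ M.1.parts := (e.symm i).2
      refine ⟨M.1.subset hmem ha, ?_⟩
      simp only [c, ← e.eq_symm_apply]
      exact Subtype.ext (M.1.part_eq_of_mem hmem ha)
  refine ⟨c, fun i => ?_, ext_edges ?_⟩
  · rw [← card_colorClass, hclass]
    exact M.2 _ (e.symm i).2
  · rw [edges_ofColoring]
    ext s
    simp only [mem_image, mem_univ, true_and, hclass]
    exact ⟨fun hs => ⟨e ⟨s, hs⟩, by simp⟩, by rintro ⟨i, rfl⟩; exact (e.symm i).2⟩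

theorem innerCount_ofColoring {r n : ℕ} (hr : 0 < r) (c : ↥(initSeg (r * n)) → Fin n)
    (hc : ∀ i, #{x | c x = i} = r) (k : ℕ) :
    (ofColoring hr c hc).innerCount k
      = #{i | ∀ x, c x = i → x ∈ ({x | (x : ℕ) ≤ k} : Finset ↥(initSeg (r * n)))} := by
  -- Colour classes are nonempty because r > 0, so counting edges is counting colours.
  have hinj : Function.Injective (colorClass c) := fun i j hij => by
    obtain ⟨x, hx⟩ : ({x | c x = i} : Finset _).Nonempty := by
      rw [← card_pos, hc]; exact hr
    have hx := (mem_filter.1 hx).2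
    have hmem : (x : ℕ) ∈ colorClass c j := hij ▸ mem_colorClass.2 ⟨x.2, hx⟩
    exact hx.symm.trans (mem_colorClass.1 hmem).2
  rw [innerCount, edges_ofColoring, filter_image, card_image_of_injective _ hinj]
  congr 1
  ext i
  simp only [mem_filter, mem_univ, true_and, Subtype.forall]
  refine forall_congr' fun a => ?_
  rw [mem_colorClass]
  constructor
  · rintro h ha hi; exact (mem_Icc.1 (h ⟨ha, hi⟩)).2
  · rintro h ⟨ha, hi⟩; exact mem_Icc.2 ⟨(mem_Icc.1 ha).1, h ha hi⟩

theorem exists_coloring {r n : ℕ} :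
    ∃ b : ↥(initSeg (r * n)) → Fin n, ∀ i, #{x | b x = i} = r := by
  have hcard : Fintype.card ↥(initSeg (r * n)) = Fintype.card (Fin n × Fin r) := by
    simp [mul_comm]
  let e := Fintype.equivOfCardEq hcard
  refine ⟨fun x => (e x).1, fun i => ?_⟩
  have : #{x | (e x).1 = i} = #(({i} : Finset (Fin n)) ×ˢ (univ : Finset (Fin r))) :=
    card_equiv e fun x => by rw [mem_product]; simp
  rw [this]; simp

theorem card_fiber_comp_perm {α ι : Type*} [Fintype α] [DecidableEq α] [DecidableEq ι] {r : ℕ}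
    {b : α → ι} (hb : ∀ i, #{x | b x = i} = r) (σ : Equiv.Perm α) (i : ι) :
    #{x | (b ∘ σ) x = i} = r := by
  rw [← hb i]
  exact card_equiv σ fun x => by simp

/-- Events for the uniform `r`-matching, computed in the permutation model. -/
theorem card_filter_mul_card_perm {r n : ℕ} (hr : 0 < r) {b : ↥(initSeg (r * n)) → Fin n}
    (hb : ∀ i, #{x | b x = i} = r) (P : RMatching r n → Prop) [DecidablePred P] :
    #{M | P M} * Fintype.card (Equiv.Perm ↥(initSeg (r * n)))
      = #{σ : Equiv.Perm ↥(initSeg (r * n)) |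
            P (ofColoring hr (b ∘ σ) (card_fiber_comp_perm hb σ))}
          * Fintype.card (RMatching r n) := by
  classical
  refine card_filter_mul_card_of_surjective
    (fun σ : Equiv.Perm ↥(initSeg (r * n)) =>
      ofColoring hr (b ∘ σ) (card_fiber_comp_perm hb σ)) (fun M => ?_) (fun g h k hgh => ?_) P
  · obtain ⟨c, hc, rfl⟩ := exists_eq_ofColoring hr M
    have hcard : ∀ i, Fintype.card {x // c x = i} = Fintype.card {x // b x = i} := fun i => by
      rw [Fintype.card_subtype, Fintype.card_subtype, hc, hb]
    -- Bijections between fibres of equal size glue to a permutation σ with b ∘ σ = c.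
    let e : ∀ i, {x // c x = i} ≃ {x // b x = i} := fun i => Fintype.equivOfCardEq (hcard i)
    refine ⟨Equiv.ofFiberEquiv e, ?_⟩
    rw [ofColoring_eq_iff]
    intro x y
    have hmap := Equiv.ofFiberEquiv_map e
    simp only [Function.comp_apply, hmap]
  · rw [ofColoring_eq_iff] at hgh ⊢
    exact fun x y => hgh (k x) (k y)

end RMatching

/-! ### Binomial ratios and the curve t - t^r -/

section Estimates

theorem pow_sub_pow_le_mul_sub {a b : ℝ} (hb : 0 ≤ b) (hab : b ≤ a) (ha : a ≤ 1) (r : ℕ) :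
    a ^ r - b ^ r ≤ r * (a - b) := by
  induction r with
  | zero => simp
  | succ r ih =>
    have h1 : a ^ r ≤ 1 := pow_le_one₀ (hb.trans hab) ha
    have h2 : a ^ (r + 1) - b ^ (r + 1) = a ^ r * (a - b) + b * (a ^ r - b ^ r) := by ring
    have h3 : 0 ≤ a ^ r - b ^ r := sub_nonneg.2 (pow_le_pow_left₀ hb hab r)
    rw [h2]; push_cast
    nlinarith [mul_le_mul_of_nonneg_right h1 (sub_nonneg.2 hab),
      mul_le_mul_of_nonneg_right (hab.trans ha) h3]

/-- Factor by factor this is (k - i)/(m - i) ≤ k/m, cross-multiplied so that truncated subtraction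
is harmless. -/
theorem descFactorial_mul_pow_le {k m : ℕ} (hkm : k ≤ m) (r : ℕ) :
    k.descFactorial r * m ^ r ≤ k ^ r * m.descFactorial r := by
  induction r with
  | zero => simp
  | succ r ih =>
    have h : (k - r) * m ≤ k * (m - r) := by
      rw [Nat.sub_mul, Nat.mul_sub]
      exact Nat.sub_le_sub_left (by rw [mul_comm]; exact Nat.mul_le_mul_left r hkm) _
    rw [Nat.descFactorial_succ, Nat.descFactorial_succ]
    calc _ = ((k - r) * m) * (k.descFactorial r * m ^ r) := by ring
      _ ≤ (k * (m - r)) * (k ^ r * m.descFactorial r) := Nat.mul_le_mul h ih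
      _ = _ := by ring

/-- The ratio lies between ((k+1-r)/m)^r and (k/m)^r; the bases differ by at most r/m and x^r is
r-Lipschitz on [0,1]. -/
theorem abs_choose_div_choose_sub_pow_le {k m r : ℕ} (hm : 0 < m) (hkm : k ≤ m) (hrm : r ≤ m) :
    |(k.choose r : ℝ) / m.choose r - (k / m) ^ r| ≤ r ^ 2 / m := by
  have hm' : (0 : ℝ) < m := by exact_mod_cast hm
  have hdf : (0 : ℝ) < m.descFactorial r := by
    exact_mod_cast Nat.pos_of_ne_zero fun h => by
      rw [Nat.descFactorial_eq_zero_iff_lt] at h; omega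
  have hdiv : (k.choose r : ℝ) / m.choose r = k.descFactorial r / m.descFactorial r := by
    rw [Nat.descFactorial_eq_factorial_mul_choose, Nat.descFactorial_eq_factorial_mul_choose]
    push_cast
    rw [mul_div_mul_left _ _ (by exact_mod_cast r.factorial_ne_zero)]
  have hupper : (k.descFactorial r : ℝ) / m.descFactorial r ≤ (k / m) ^ r := by
    rw [div_pow, div_le_div_iff₀ hdf (by positivity)]
    exact_mod_cast descFactorial_mul_pow_le hkm r
  have hlower : (((k + 1 - r : ℕ) : ℝ) / m) ^ r ≤ k.descFactorial r / m.descFactorial r := by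
    rw [div_pow]
    refine div_le_div₀ (by positivity) ?_ hdf ?_
    · exact_mod_cast Nat.pow_sub_le_descFactorial k r
    · exact_mod_cast Nat.descFactorial_le_pow m r
  have hgap : ((k : ℝ) / m) ^ r - (((k + 1 - r : ℕ) : ℝ) / m) ^ r ≤ r ^ 2 / m := by
    rcases Nat.eq_zero_or_pos r with rfl | hr
    · simp
    refine (pow_sub_pow_le_mul_sub (by positivity) ?_ ?_ r).trans ?_
    · gcongr; omega
    · rw [div_le_one hm']; exact_mod_cast hkm
    · rw [← sub_div, sq, mul_div_assoc]
      gcongr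
      rw [sub_le_iff_le_add]
      exact_mod_cast (by omega : k ≤ r + (k + 1 - r))
  rw [hdiv, abs_le]
  exact ⟨by linarith, by linarith [show (0 : ℝ) ≤ r ^ 2 / m by positivity]⟩

/-- The curve `t - t ^ r` lies below its horizontal tangent. -/
theorem sub_pow_le_of_pow_eq_inv {r : ℕ} (hr : 2 ≤ r) {τ t : ℝ} (hτ : 0 < τ)
    (hτr : r * τ ^ (r - 1) = 1) (ht : 0 ≤ t) : t - t ^ r ≤ τ - τ ^ r := by
  -- Bernoulli's inequality, scaled by τ^r, is the tangent bound for t^r at τ, where the slope is 1.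
  have h := one_add_mul_le_pow (a := t / τ - 1) (by linarith [div_nonneg ht hτ.le]) r
  have hpow : τ ^ r = τ ^ (r - 1) * τ := (pow_sub_one_mul (by omega) τ).symm
  have h1 : τ ^ r * (1 + r * (t / τ - 1)) ≤ τ ^ r * (1 + (t / τ - 1)) ^ r := by gcongr
  have h2 : τ ^ r * (1 + (t / τ - 1)) ^ r = t ^ r := by
    rw [add_sub_cancel, div_pow, mul_div_cancel₀ _ (by positivity)]
  have h3 : τ ^ r * (1 + r * (t / τ - 1)) = τ ^ r + (t - τ) := by
    calc _ = τ ^ r + (r * τ ^ (r - 1)) * (τ * (t / τ) - τ) := by rw [hpow]; ring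
      _ = _ := by rw [hτr, mul_div_cancel₀ _ hτ.ne', one_mul]
  linarith

end Estimates

/-! ### Deviation of inner counts and of the sock number -/

namespace RMatching

open Finset
open scoped BigOperators

theorem card_filter_val_le {m k : ℕ} (hk : k ≤ m) :
    #({x | (x : ℕ) ≤ k} : Finset ↥(initSeg m)) = k := by
  rw [← card_map (Function.Embedding.subtype _)]
  have : ({x | (x : ℕ) ≤ k} : Finset ↥(initSeg m)).map (Function.Embedding.subtype _)
      = Icc 1 k := by
    ext a
    simp only [mem_map, mem_filter, mem_univ, true_and, Function.Embedding.subtype_apply,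
      Subtype.exists, exists_and_right, exists_eq_right, mem_Icc]
    constructor
    · rintro ⟨ha, hak⟩; exact ⟨ha.1, hak⟩
    · rintro ⟨ha, hak⟩; exact ⟨⟨ha, hak.trans hk⟩, hak⟩
  rw [this, Nat.card_Icc, add_tsub_cancel_right]

theorem card_innerCount_deviation_le {r n k : ℕ} (hr : 0 < r) (hn : 0 < n) (hk : k ≤ r * n)
    {s : ℝ} (hs : 0 ≤ s) :
    (#{M : RMatching r n |
        s ≤ |(M.innerCount k : ℝ) - n * (k.choose r / (r * n).choose r)|} : ℝ)
      ≤ 2 * Real.exp (-(s ^ 2 / (32 * (r * n)))) * Fintype.card (RMatching r n) := by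
  classical
  obtain ⟨b, hb⟩ := exists_coloring (r := r) (n := n)
  have hcard : Fintype.card ↥(initSeg (r * n)) = r * n := by simp
  have : Nonempty ↥(initSeg (r * n)) :=
    Fintype.card_pos_iff.1 (by rw [hcard]; positivity)
  set K : Finset ↥(initSeg (r * n)) := {x | (x : ℕ) ≤ k} with hK
  let f : Equiv.Perm ↥(initSeg (r * n)) → ℝ :=
    fun σ => (#{i | ∀ x, b (σ x) = i → x ∈ K} : ℝ)
  have hexp : 𝔼 σ, f σ = n * (k.choose r / (r * n).choose r) := by
    rw [expect_card_fiber_subset b hb (by rw [hcard]; exact Nat.le_mul_of_pos_right r hn) K,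
      hcard, hK, card_filter_val_le hk, Fintype.card_fin]
  have hconc := card_perm_le_abs_sub_expect (c := 2) two_pos hs f fun σ x y =>
    abs_card_fiber_subset_swap_sub_le b K σ x y
  have htransfer := card_filter_mul_card_perm hr hb
    fun M => s ≤ |(M.innerCount k : ℝ) - n * (k.choose r / (r * n).choose r)|
  simp only [innerCount_ofColoring] at htransfer
  rw [hexp, hcard] at hconc
  have hP : (0 : ℝ) < Fintype.card (Equiv.Perm ↥(initSeg (r * n))) := by
    exact_mod_cast Fintype.card_pos
  rw [← mul_le_mul_iff_left₀ hP]
  calc _ = _ := by exact_mod_cast htransfer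
    _ ≤ _ := mul_le_mul_of_nonneg_right hconc (Nat.cast_nonneg _)
    _ = _ := by push_cast; ring_nf

/-- If all counts of inner edges are close to their means, then the sock number is close to
`(r - 1) n τ`, where `τ` maximises `t - t ^ r`. -/
theorem abs_sockNumber_sub_le {r n : ℕ} (hr : 2 ≤ r) (hn : 0 < n) {τ s : ℝ} (hτ : 0 < τ)
    (hτ1 : τ ≤ 1) (hτr : r * τ ^ (r - 1) = 1) (M : RMatching r n)
    (hM : ∀ k ∈ initSeg (r * n),
      |(M.innerCount k : ℝ) - n * (k.choose r / (r * n).choose r)| ≤ s) :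
    |(M.sockNumber : ℝ) - (r - 1) * n * τ| ≤ r * s + (r ^ 2 + r) := by
  have hr0 : (0 : ℝ) < r := by exact_mod_cast (by omega : 0 < r)
  have hn0 : (0 : ℝ) < n := by exact_mod_cast hn
  have hrn : 0 < r * n := by positivity
  have hx : ∀ k ∈ initSeg (r * n),
      |(M.sockuence k : ℝ) - r * n * ((k / (r * n)) - (k / (r * n)) ^ r)| ≤ r * s + r ^ 2 := by
    intro k hk
    have hk' := (mem_Icc.1 hk).2
    have h1 : (M.sockuence k : ℝ) + r * M.innerCount k = k := by
      exact_mod_cast M.sockuence_add_mul_innerCount hk'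
    have h2 := abs_choose_div_choose_sub_pow_le hrn hk' (Nat.le_mul_of_pos_right r hn)
    push_cast at h2
    have h3 : (M.sockuence k : ℝ) - r * n * ((k / (r * n)) - (k / (r * n)) ^ r)
        = -(r * (M.innerCount k - n * (k.choose r / (r * n).choose r)))
          - r * n * (k.choose r / (r * n).choose r - (k / (r * n)) ^ r) := by
      have : (r : ℝ) * n * (k / (r * n)) = k := by field_simp
      linear_combination h1 - this
    have h4 : (r : ℝ) * n * (r ^ 2 / (r * n)) = r ^ 2 := by field_simp
    rw [h3]
    refine (abs_sub _ _).trans ?_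
    rw [abs_neg, abs_mul, abs_mul, abs_of_pos hr0, abs_of_pos (by positivity : (0 : ℝ) < r * n),
      ← h4]
    gcongr
    exact hM k hk
  have hmax : (r : ℝ) * n * (τ - τ ^ r) = (r - 1) * n * τ := by
    rw [← pow_sub_one_mul (by omega : r ≠ 0) τ]
    linear_combination (-(n * τ) : ℝ) * hτr
  have hrs : 0 ≤ (r : ℝ) := hr0.le
  rw [abs_sub_le_iff]
  constructor
  · obtain ⟨k, hk, hsup⟩ := exists_mem_eq_sup (initSeg (r * n)) ⟨1, mem_Icc.2 ⟨le_rfl, hrn⟩⟩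
      M.sockuence
    have h1 := (abs_le.1 (hx k hk)).2
    have h2 := sub_pow_le_of_pow_eq_inv hr hτ hτr
      (show (0 : ℝ) ≤ k / (r * n) by positivity)
    have h3 := mul_le_mul_of_nonneg_left h2 (by positivity : (0 : ℝ) ≤ r * n)
    rw [sockNumber, hsup]
    linarith
  -- Rounding up keeps 1 ≤ k ≤ rn and k/(rn) ≥ τ. It can only increase the linear term, and it
  -- raises rn t^r by at most r, which is the extra `r` in the bound.
  · set k := ⌈τ * (r * n)⌉₊ with hkdef
    have hk : k ∈ initSeg (r * n) := by
      refine mem_Icc.2 ⟨Nat.ceil_pos.2 (by positivity), Nat.ceil_le.2 ?_⟩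
      push_cast
      exact mul_le_of_le_one_left (by positivity) hτ1
    have h1 := (abs_le.1 (hx k hk)).1
    have hlow : τ ≤ k / (r * n) := by rw [le_div_iff₀ (by positivity)]; exact Nat.le_ceil _
    have hhigh : (k : ℝ) - r * n * τ ≤ 1 := by
      have := Nat.ceil_lt_add_one (show 0 ≤ τ * (r * n) by positivity)
      rw [← hkdef] at this
      linarith
    have hle1 : (k : ℝ) / (r * n) ≤ 1 := by
      rw [div_le_one (by positivity)]; exact_mod_cast (mem_Icc.1 hk).2
    have h2 := mul_le_mul_of_nonneg_left (pow_sub_pow_le_mul_sub hτ.le hlow hle1 r)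
      (by positivity : (0 : ℝ) ≤ r * n)
    have h3 : (r : ℝ) * n * (k / (r * n)) = k := by field_simp
    have h4 : (r : ℝ) * n * (r * (k / (r * n) - τ)) ≤ r := by
      calc _ = r * ((r : ℝ) * n * (k / (r * n)) - r * n * τ) := by ring
        _ ≤ r * 1 := by rw [h3]; gcongr
        _ = r := mul_one _
    have h5 : (M.sockuence k : ℝ) ≤ M.sockNumber := by
      exact_mod_cast le_sup (f := M.sockuence) hk
    have h6 := mul_le_mul_of_nonneg_left hlow (by positivity : (0 : ℝ) ≤ r * n)
    linarith

instance instNonempty {r n : ℕ} [hr : NeZero r] : Nonempty (RMatching r n) := by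
  obtain ⟨b, hb⟩ := exists_coloring (r := r) (n := n)
  exact ⟨ofColoring (NeZero.pos r) b hb⟩

instance instDiscreteMeasurableSpace (r n : ℕ) : DiscreteMeasurableSpace (RMatching r n) :=
  ⟨fun _ => trivial⟩

theorem uniformLaw_finset {r n : ℕ} (s : Finset (RMatching r n)) :
    uniformLaw r n s = #s / Fintype.card (RMatching r n) := by
  rw [uniformLaw, ProbabilityTheory.uniformOn_univ,
    MeasureTheory.Measure.count_apply_finset]

theorem uniformLaw_exists_deviation_le {r n : ℕ} [NeZero r] (hn : 2 ≤ n) :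
    uniformLaw r n {M | ∃ k ∈ initSeg (r * n),
        8 * Real.sqrt r * Real.sqrt (n * Real.log n)
          ≤ |(M.innerCount k : ℝ) - n * (k.choose r / (r * n).choose r)|}
      ≤ ENNReal.ofReal (2 * r / n) := by
  classical
  set s : ℝ := 8 * Real.sqrt r * Real.sqrt (n * Real.log n) with hs
  have hr : 0 < r := NeZero.pos r
  have hr0 : (0 : ℝ) < r := by exact_mod_cast hr
  have hn0 : (0 : ℝ) < n := by exact_mod_cast (by omega : 0 < n)
  have hlog : 0 ≤ Real.log n := Real.log_nonneg (by exact_mod_cast (by omega : 1 ≤ n))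
  -- The factor 8√r in `s` gives s²/(32rn) = 2 log n: each k fails with probability at most 2/n²,
  -- and the rn values of k together with at most 2r/n.
  have hexp : Real.exp (-(s ^ 2 / (32 * (r * n)))) = ((n : ℝ) ^ 2)⁻¹ := by
    have : s ^ 2 / (32 * (r * n)) = 2 * Real.log n := by
      rw [hs, mul_pow, mul_pow, Real.sq_sqrt hr0.le, Real.sq_sqrt (by positivity)]
      field_simp; ring
    rw [this, Real.exp_neg, ← Nat.cast_two, ← Real.log_pow, Real.exp_log (by positivity)]
  let B : ℕ → Finset (RMatching r n) := fun k =>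
    {M | s ≤ |(M.innerCount k : ℝ) - n * (k.choose r / (r * n).choose r)|}
  have hset : {M : RMatching r n | ∃ k ∈ initSeg (r * n),
      s ≤ |(M.innerCount k : ℝ) - n * (k.choose r / (r * n).choose r)|}
      = ↑((initSeg (r * n)).biUnion B) := by
    ext M; simp [B]
  have hB : ∀ k ∈ initSeg (r * n),
      (#(B k) : ℝ) ≤ 2 * ((n : ℝ) ^ 2)⁻¹ * Fintype.card (RMatching r n) := fun k hk => by
    rw [← hexp]
    exact card_innerCount_deviation_le hr (by omega) (mem_Icc.1 hk).2 (by positivity)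
  have hcardpos : (0 : ℝ) < Fintype.card (RMatching r n) := by exact_mod_cast Fintype.card_pos
  rw [hset, uniformLaw_finset, ← ENNReal.ofReal_natCast, ← ENNReal.ofReal_natCast,
    ← ENNReal.ofReal_div_of_pos hcardpos]
  refine ENNReal.ofReal_le_ofReal ?_
  rw [div_le_iff₀ hcardpos]
  calc (#((initSeg (r * n)).biUnion B) : ℝ) ≤ ∑ k ∈ initSeg (r * n), (#(B k) : ℝ) := by
        exact_mod_cast card_biUnion_le
    _ ≤ ∑ _k ∈ initSeg (r * n), 2 * ((n : ℝ) ^ 2)⁻¹ * Fintype.card (RMatching r n) :=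
        sum_le_sum hB
    _ = _ := by
        rw [sum_const, Nat.card_Icc, add_tsub_cancel_right, nsmul_eq_mul]
        push_cast
        field_simp

end RMatching

/-! ### The limit -/

theorem theorem4 (r : ℕ) (hr : 2 ≤ r) :
    ∃ C : ℝ, 0 < C ∧
      Filter.Tendsto
        (fun n : ℕ => RMatching.uniformLaw r n
          {M : RMatching r n |
            |(M.sockNumber : ℝ) - ((r : ℝ) - 1) * (n : ℝ) / (r : ℝ) ^ (1 / ((r : ℝ) - 1))|
              ≤ C * Real.sqrt ((n : ℝ) * Real.log (n : ℝ))})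
        Filter.atTop (nhds 1) := by
  have : NeZero r := ⟨by omega⟩
  have hr0 : (0 : ℝ) < r := by exact_mod_cast (by omega : 0 < r)
  have hr1 : (1 : ℝ) ≤ r := by exact_mod_cast (by omega : 1 ≤ r)
  have hsub : (r : ℝ) - 1 = (r - 1 : ℕ) := by
    rw [Nat.cast_sub (by omega), Nat.cast_one]
  set ρ : ℝ := (r : ℝ) ^ (1 / ((r : ℝ) - 1)) with hρ
  have hρ1 : 1 ≤ ρ := Real.one_le_rpow hr1 (by rw [hsub]; positivity)
  have hρ0 : 0 < ρ := one_pos.trans_le hρ1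
  have hρpow : ρ ^ (r - 1) = r := by
    rw [hρ, hsub, one_div, Real.rpow_inv_natCast_pow hr0.le (by omega)]
  have hτr : r * ρ⁻¹ ^ (r - 1) = 1 := by rw [inv_pow, hρpow, mul_inv_cancel₀ hr0.ne']
  -- The first term is r times the deviation allowed for inner counts. The second absorbs the
  -- additive error r² + r, since √(n log n) ≥ 1 once n ≥ 3.
  refine ⟨r * (8 * Real.sqrt r) + (r ^ 2 + r), by positivity, ?_⟩
  have hprob : ∀ n, MeasureTheory.IsProbabilityMeasure (RMatching.uniformLaw r n) := fun n =>
    ProbabilityTheory.isProbabilityMeasure_uniformOn Set.finite_univ Set.univ_nonempty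
  have hlim : Filter.Tendsto (fun n : ℕ => 1 - ENNReal.ofReal (2 * r / n)) Filter.atTop
      (nhds 1) := by
    have h := ENNReal.tendsto_ofReal (tendsto_const_div_atTop_nhds_zero_nat (2 * (r : ℝ)))
    simpa using ENNReal.Tendsto.sub (tendsto_const_nhds (x := 1)) h (Or.inl ENNReal.one_ne_top)
  refine tendsto_of_tendsto_of_tendsto_of_le_of_le' hlim tendsto_const_nhds ?_
    (Filter.Eventually.of_forall fun n => MeasureTheory.prob_le_one)
  filter_upwards [Filter.eventually_ge_atTop 3] with n hn
  have hn3 : (3 : ℝ) ≤ n := by exact_mod_cast hn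
  have hsqrt : 1 ≤ Real.sqrt (n * Real.log n) := by
    have hlog : 1 ≤ Real.log n := by
      rw [Real.le_log_iff_exp_le (by linarith)]
      linarith [Real.exp_one_lt_d9]
    rw [Real.one_le_sqrt]
    nlinarith
  set bad := {M : RMatching r n | ∃ k ∈ initSeg (r * n),
        8 * Real.sqrt r * Real.sqrt (n * Real.log n)
          ≤ |(M.innerCount k : ℝ) - n * (k.choose r / (r * n).choose r)|} with hbad
  calc 1 - ENNReal.ofReal (2 * r / n) ≤ 1 - RMatching.uniformLaw r n bad :=
        tsub_le_tsub_left (RMatching.uniformLaw_exists_deviation_le (by omega)) _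
    _ = RMatching.uniformLaw r n badᶜ := (MeasureTheory.prob_compl_eq_one_sub .of_discrete).symm
    _ ≤ _ := MeasureTheory.measure_mono fun M hM => by
        have hM' : ∀ k ∈ initSeg (r * n),
            |(M.innerCount k : ℝ) - n * (k.choose r / (r * n).choose r)|
              ≤ 8 * Real.sqrt r * Real.sqrt (n * Real.log n) := fun k hk =>
          le_of_not_ge fun h => hM ⟨k, hk, h⟩
        have h := M.abs_sockNumber_sub_le hr (by omega) (inv_pos.2 hρ0) (inv_le_one_of_one_le₀ hρ1)
          hτr hM'
        rw [← div_eq_mul_inv] at h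
        refine h.trans ?_
        have h2 := mul_le_mul_of_nonneg_left hsqrt (by positivity : (0 : ℝ) ≤ r ^ 2 + r)
        linarith
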